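/- Let $\mathcal H=\bigotimes_{j=1}^m \mathbb C^{d_j}$ be a multipartite Hilbert space with local dimensions $d_j\ge 1$, and let $\mu$ be the uniform probability measure on the projective space $\mathrm P(\mathcal H)$ of pure states, i.e. the distribution of $U\psi_0$ for a fixed pure state $\psi_0$ and a Haar-random unitary $U$ on $\mathcal H$. Pure states $\psi_1,\dots,\psi_n\in \mathrm P(\mathcal H)$ are called *unambiguously locally distinguishable* if there is a POVM $\{E_k\}_{k=0,\dots,n}$ on $\mathcal H$ that can be implemented by local operations and classical communication (a protocol of finitely many rounds; in each round one party performs a local measurement with finitely many outcomes and broadcasts the outcome, and all later actions may depend on it) such that for all $k,j\in\{1,\dots,n\}$ $$\langle\psi_j|E_k|\psi_j\rangle=0 \quad\text{if and only if}\quad j\neq k .$$ **Theorem.** For every $n$, for almost all $n$-tuples $(\psi_1,\dots,\psi_n)$ of pure states of $\mathcal H$ with respect to the product measure $\mu\times\dots\times\mu$, the states $\psi_1,\dots,\psi_n$ are unambiguously locally distinguishable if and only if $$n\;\le\;1+\sum_{j=1}^m (d_j-1).$$ In other words, if $n\le 1+\sum_j(d_j-1)$ then almost all $n$-tuples are unambiguously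 locally distinguishable, and if $n> 1+\sum_j(d_j-1)$ then almost all $n$-tuples are not. -/

import Mathlib

open MeasureTheory
open scoped LinearAlgebra.Projectivization ComplexOrder

noncomputable section

namespace LocalDiscrimination

/-! ### The uniform probability measure on projective Hilbert space -/

section UniformMeasure

variable {H : Type*} [NormedAddCommGroup H] [InnerProductSpace ℂ H]

/-- Projective Hilbert space carries the quotient topology of the punctured Hilbert space. -/
instance projectiveTopology : TopologicalSpace (ℙ ℂ H) :=
  inferInstanceAs (TopologicalSpace (Quotient (projectivizationSetoid ℂ H)))

instance projectiveMeasurableSpace : MeasurableSpace (ℙ ℂ H) := borel _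

instance projectiveBorelSpace : BorelSpace (ℙ ℂ H) := ⟨rfl⟩

variable [CompleteSpace H]

theorem continuous_unitary_smul (ψ₀ : ℙ ℂ H) :
    Continuous fun U : unitary (H →L[ℂ] H) => U • ψ₀ := by
  induction ψ₀ using Projectivization.ind with
  | h v hv =>
    have h : Continuous fun U : unitary (H →L[ℂ] H) =>
        (⟨U • v, (smul_ne_zero_iff_ne U).mpr hv⟩ : {w : H // w ≠ 0}) := by
      refine Continuous.subtype_mk ?_ _
      exact (ContinuousLinearMap.apply ℂ H v).continuous.comp continuous_subtype_val
    exact (continuous_quotient_mk' (s := projectivizationSetoid ℂ H)).comp h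

variable [FiniteDimensional ℂ H]

/-- The unitary group of a finite-dimensional Hilbert space (in the operator norm topology) is
compact. -/
instance compactSpace_unitary : CompactSpace (unitary (H →L[ℂ] H)) := by
  have : ProperSpace (H →L[ℂ] H) := FiniteDimensional.proper ℂ _
  refine isCompact_iff_compactSpace.mp (Metric.isCompact_of_isClosed_isBounded isClosed_unitary ?_)
  refine (Metric.isBounded_iff_subset_closedBall 0).2 ⟨1, fun U hU => ?_⟩
  rw [mem_closedBall_zero_iff]
  refine ContinuousLinearMap.opNorm_le_bound _ zero_le_one fun x => ?_
  rw [ContinuousLinearMap.norm_map_of_mem_unitary hU, one_mul]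

/-- The Haar measure of the unitary group, normalised to total mass one. -/
def unitaryHaar (H : Type*) [NormedAddCommGroup H] [InnerProductSpace ℂ H]
    [CompleteSpace H] [FiniteDimensional ℂ H] : Measure (unitary (H →L[ℂ] H)) :=
  Measure.haarMeasure ⊤

/-- The uniform probability measure on pure states (points of projective Hilbert space): the
distribution of `U ψ₀` for a fixed pure state `ψ₀` and a Haar random unitary `U`. It does not
depend on the choice of `ψ₀`, by right invariance of the Haar measure of a compact group. -/
def uniformMeasure (ψ₀ : ℙ ℂ H) : Measure (ℙ ℂ H) :=
  (unitaryHaar H).map fun U => U • ψ₀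

instance isProbabilityMeasure_unitaryHaar : IsProbabilityMeasure (unitaryHaar H) :=
  ⟨Measure.haarMeasure_self (K₀ := (⊤ : TopologicalSpace.PositiveCompacts (unitary (H →L[ℂ] H))))⟩

instance isProbabilityMeasure_uniformMeasure (ψ₀ : ℙ ℂ H) :
    IsProbabilityMeasure (uniformMeasure ψ₀) :=
  Measure.isProbabilityMeasure_map (continuous_unitary_smul ψ₀).measurable.aemeasurable

end UniformMeasure

/-! ### Multipartite systems -/

/-- The labels of the product basis of a system of `m` parties with local dimensions `d j`. -/
abbrev Idx {m : ℕ} (d : Fin m → ℕ) : Type := ∀ j, Fin (d j)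

/-- The multipartite Hilbert space `⨂ⱼ ℂ^(d j)`, in coordinates with respect to the product basis:
the product vector `⨂ⱼ vⱼ` is `x ↦ ∏ j, vⱼ (x j)`. -/
abbrev HilbertSpace {m : ℕ} (d : Fin m → ℕ) : Type := EuclideanSpace ℂ (Idx d)

/-- Pure states: the points of projective Hilbert space. -/
abbrev PureState {m : ℕ} (d : Fin m → ℕ) : Type := ℙ ℂ (HilbertSpace d)

/-- Linear maps from the system with local dimensions `d` to the system with local dimensions `e`,
as matrices in the product bases. -/
abbrev Operator {m : ℕ} (e d : Fin m → ℕ) : Type := Matrix (Idx e) (Idx d) ℂ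

/-- The tensor product `⨂ⱼ Bⱼ` of linear maps `Bⱼ : ℂ^(d j) → ℂ^(e j)` of the single parties. -/
def tensorOp {m : ℕ} {e d : Fin m → ℕ} (B : ∀ j, Matrix (Fin (e j)) (Fin (d j)) ℂ) :
    Operator e d :=
  Matrix.of fun x y => ∏ j, B j (x j) (y j)

/-- A positive operator valued measure with finitely many outcomes `k : K`. -/
def IsPOVM {m : ℕ} {d : Fin m → ℕ} {K : Type*} [Fintype K] (E : K → Operator d d) : Prop :=
  (∀ k, (E k).PosSemidef) ∧ ∑ k, E k = 1

/-- `LOCC d E`: the outcome statistics `E` (indexed by final results `k : K`) are those of a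
protocol of finitely many rounds of local operations and classical communication, starting on the
system with local dimensions `d`.

* `announce`: the parties stop and declare the result `k₀`.
* `round`: party `p` performs a local measurement with finitely many outcomes `a` and Kraus
  operators `B a p`, and broadcasts `a`. Each other party `j` applies an isometry `B a j` of its own
  (for instance the identity). The local dimensions `e a` afterwards are arbitrary, so that parties
  may adjoin or discard local systems. Then the parties follow a protocol, with statistics `F a`,
  which may depend on `a`. -/
inductive LOCC {m : ℕ} {K : Type} [DecidableEq K] :
    (d : Fin m → ℕ) → (K → Operator d d) → Prop
  | announce (d : Fin m → ℕ) (k₀ : K) : LOCC d fun k => if k = k₀ then 1 else 0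
  | round (d : Fin m → ℕ) (p : Fin m) (r : ℕ) (e : Fin r → Fin m → ℕ)
      (B : ∀ (a : Fin r) (j : Fin m), Matrix (Fin (e a j)) (Fin (d j)) ℂ)
      (F : ∀ a : Fin r, K → Operator (e a) (e a))
      (measurement : ∑ a, (B a p).conjTranspose * B a p = 1)
      (isometry : ∀ a j, j ≠ p → (B a j).conjTranspose * B a j = 1)
      (continuation : ∀ a, LOCC (e a) (F a)) :
      LOCC d fun k => ∑ a, (tensorOp (B a)).conjTranspose * F a k * tensorOp (B a)

/-- The expectation value `⟨ψ|E|ψ⟩` of an operator in a pure state, for a normalised vector `|ψ⟩`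
representing `ψ` (whence the division by the squared norm of the representative). -/
def expectation {m : ℕ} {d : Fin m → ℕ} (E : Operator d d) (ψ : PureState d) : ℂ :=
  inner ℂ ψ.rep (Matrix.toEuclideanLin E ψ.rep) / (‖ψ.rep‖ : ℂ) ^ 2

/-- The pure states `ψ₁, …, ψₙ` are unambiguously distinguishable by LOCC: there is an LOCC
decomposable POVM `E₀, E₁, …, Eₙ` whose outcome `k > 0` has nonzero probability on `ψₖ` and
probability zero on all `ψⱼ` with `j ≠ k`. Outcome `0` is inconclusive. (The states are indexed by
`Fin n`, and outcome `k.succ` of the POVM belongs to the state with index `k`.) -/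
def UnambiguouslyLocallyDistinguishable {m : ℕ} {d : Fin m → ℕ} {n : ℕ}
    (ψ : Fin n → PureState d) : Prop :=
  ∃ E : Fin (n + 1) → Operator d d, IsPOVM E ∧ LOCC d E ∧
    ∀ k j : Fin n, expectation (E k.succ) (ψ j) = 0 ↔ j ≠ k

end LocalDiscrimination

end

/-! Each effect of an LOCC protocol is a sum of rank one operators given by product functionals φ
(`LOCC.mem_separableCone`). By positivity, every summand of `E k.succ` vanishes on the states other
than ψₖ. So unambiguous discrimination yields, for each k, a product functional that kills all
states except ψₖ. Conversely, such functionals suffice when n is within the bound: draw k at random,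
let every party project onto its factor of φₖ, and announce k if all succeed.

It remains to decide when such functionals exist for generic states. Up to scale, nonzero product
functionals form the Segre variety, of dimension N = ∑ (d j - 1), and each state to be killed
imposes one linear equation. If n - 1 ≤ N, Krull's height theorem and the Nullstellensatz solve the
equations for any n - 1 states (`exists_productPairing_eq_zero`), and by Fubini the remaining state
is almost surely not killed. If n - 1 > N, the tuples admitting a solution lie in finitely many C¹
images of spaces of too small a dimension, hence in a null set.

Null sets are computed for Lebesgue measure on vectors and transferred to states by
`ae_pi_uniformMeasure`. -/

noncomputable section

namespace LocalDiscrimination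

/-! ### The homogeneous coordinate ring of the Segre variety -/

section Segre

open MvPolynomial

variable {m : ℕ} {d : Fin m → ℕ}

/-- The coordinate of a product vector with label `x`, as a monomial in the coordinates of the
factors. -/
def segreMonomial (x : Idx d) : MvPolynomial (Σ j, Fin (d j)) ℂ :=
  ∏ j, X ⟨j, x j⟩

/-- The homogeneous coordinate ring of the Segre variety of product vectors. -/
def segreRing (d : Fin m → ℕ) : Subalgebra ℂ (MvPolynomial (Σ j, Fin (d j)) ℂ) :=
  Algebra.adjoin ℂ (Set.range segreMonomial)

/-- The monomial `segreMonomial x` as an element of the Segre ring. -/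
def segreCoord (x : Idx d) : segreRing d :=
  ⟨segreMonomial x, Algebra.subset_adjoin ⟨x, rfl⟩⟩

instance finiteType_segreRing : Algebra.FiniteType ℂ (segreRing d) :=
  (Subalgebra.fg_iff_finiteType _).1
    ⟨(Set.finite_range segreMonomial).toFinset, by rw [Set.Finite.coe_toFinset]; rfl⟩

instance isNoetherianRing_segreRing : IsNoetherianRing (segreRing d) :=
  Algebra.FiniteType.isNoetherianRing ℂ _

open Classical in
/-- Setting the variables outside of `S` to zero. -/
def restrictVars (S : ∀ j, Finset (Fin (d j))) :
    MvPolynomial (Σ j, Fin (d j)) ℂ →ₐ[ℂ] MvPolynomial (Σ j, Fin (d j)) ℂ :=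
  aeval fun i => if i.2 ∈ S i.1 then X i else 0

theorem restrictVars_comp {S S' : ∀ j, Finset (Fin (d j))} (h : ∀ j, S j ⊆ S' j) :
    (restrictVars S).comp (restrictVars S') = restrictVars S := by
  ext1 i
  simp only [restrictVars, AlgHom.comp_apply, aeval_X]
  by_cases h' : i.2 ∈ S' i.1
  · simp [h']
  · have : i.2 ∉ S i.1 := fun hi => h' (h _ hi)
    simp [h', this]

/-- The ideal of the product vectors whose factors are supported in `S`. -/
def supportIdeal (S : ∀ j, Finset (Fin (d j))) : Ideal (segreRing d) :=
  RingHom.ker ((restrictVars S).comp (segreRing d).val)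

instance isPrime_supportIdeal (S : ∀ j, Finset (Fin (d j))) : (supportIdeal S).IsPrime :=
  RingHom.ker_isPrime _

theorem mem_supportIdeal {S : ∀ j, Finset (Fin (d j))} {f : segreRing d} :
    f ∈ supportIdeal S ↔ restrictVars S f = 0 := Iff.rfl

theorem supportIdeal_anti {S S' : ∀ j, Finset (Fin (d j))} (h : ∀ j, S j ⊆ S' j) :
    supportIdeal S' ≤ supportIdeal S := fun f hf => by
  rw [mem_supportIdeal] at hf ⊢
  rw [← restrictVars_comp h, AlgHom.comp_apply, hf, map_zero]

theorem segreCoord_mem_supportIdeal {S : ∀ j, Finset (Fin (d j))} {x : Idx d} :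
    segreCoord x ∈ supportIdeal S ↔ ∃ j, x j ∉ S j := by
  simp only [mem_supportIdeal, segreCoord, segreMonomial, map_prod, restrictVars, aeval_X,
    Finset.prod_eq_zero_iff, Finset.mem_univ, true_and]
  refine exists_congr fun j => ?_
  by_cases h : x j ∈ S j <;> simp [h]

/-- The inclusion is strict because of a coordinate whose labels all lie in `S'` but whose `j`-th
label is outside `S j`; it exists as no `S' j` is empty. -/
theorem supportIdeal_lt {S S' : ∀ j, Finset (Fin (d j))} (h : ∀ j, S j ⊆ S' j) {j : Fin m}
    (hj : S j ≠ S' j) (hS : ∀ j, (S' j).Nonempty) : supportIdeal S' < supportIdeal S := by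
  refine lt_of_le_of_ne (supportIdeal_anti h) fun he => ?_
  obtain ⟨i, hi, hi'⟩ : ∃ i ∈ S' j, i ∉ S j := by
    by_contra! hc
    exact hj ((h j).antisymm hc)
  choose x hx using hS
  have h1 : segreCoord (Function.update x j i) ∈ supportIdeal S :=
    segreCoord_mem_supportIdeal.2 ⟨j, by simpa using hi'⟩
  rw [← he, segreCoord_mem_supportIdeal] at h1
  obtain ⟨l, hl⟩ := h1
  rcases eq_or_ne l j with rfl | hlj
  · exact hl (by simpa using hi)
  · exact hl (by simpa [hlj] using hx l)

/-- Here `c` counts the labels missing from `S`. Putting them back one at a time gives a strictly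
descending chain of `c` further primes. -/
theorem le_height_supportIdeal (c : ℕ) : ∀ S : ∀ j, Finset (Fin (d j)), (∀ j, (S j).Nonempty) →
    ∑ j, (S j).card + c = ∑ j, d j → (c : ℕ∞) ≤ (supportIdeal S).height := by
  classical
  induction c with
  | zero => intros; simp
  | succ c ih =>
    intro S hS hc
    obtain ⟨j, hj⟩ : ∃ j, (S j).card < d j := by
      by_contra! h
      have := Finset.sum_le_sum fun j (_ : j ∈ Finset.univ) => h j
      omega
    obtain ⟨i, hi⟩ : ∃ i, i ∉ S j := by
      by_contra! h
      rw [Finset.eq_univ_of_forall h] at hj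
      simp at hj
    let S' := Function.update S j (insert i (S j))
    have hsub : ∀ l, S l ⊆ S' l := fun l => by
      rcases eq_or_ne l j with rfl | hl
      · simp [S']
      · simp [S', hl]
    have hlt : supportIdeal S' < supportIdeal S := by
      refine supportIdeal_lt hsub (j := j) (fun h => hi ?_) fun l => (hS l).mono (hsub l)
      rw [h]
      simp [S']
    have hcard : ∑ l, (S' l).card = ∑ l, (S l).card + 1 := by
      rw [← Finset.add_sum_erase _ _ (Finset.mem_univ j),
        ← Finset.add_sum_erase _ (fun l => (S l).card) (Finset.mem_univ j)]
      have : ∑ l ∈ Finset.univ.erase j, (S' l).card = ∑ l ∈ Finset.univ.erase j, (S l).card :=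
        Finset.sum_congr rfl fun l hl => by simp [S', Finset.ne_of_mem_erase hl]
      rw [this]
      simp [S', Finset.card_insert_of_notMem hi]
      ring
    have := ih S' (fun l => (hS l).mono (hsub l)) (by omega)
    refine le_trans ?_ (Ideal.height_add_one_le_of_lt_of_isPrime hlt)
    push_cast
    gcongr

/-- The chain down from singleton supports has ∑ (d j - 1) steps, and emptying the supports adds one
more. That last step is strict only if there is a party. -/
theorem lt_height_supportIdeal_empty (hm : 0 < m) (hd : ∀ j, 0 < d j) :
    ((∑ j, (d j - 1) : ℕ) : ℕ∞) < (supportIdeal fun j => (∅ : Finset (Fin (d j)))).height := by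
  let S : ∀ j, Finset (Fin (d j)) := fun j => {⟨0, hd j⟩}
  have h1 : supportIdeal S < supportIdeal fun j => (∅ : Finset (Fin (d j))) :=
    supportIdeal_lt (fun j => Finset.empty_subset _) (j := ⟨0, hm⟩)
      (Finset.singleton_ne_empty _).symm fun j => Finset.singleton_nonempty _
  have h2 : ((∑ j, (d j - 1) : ℕ) : ℕ∞) ≤ (supportIdeal S).height := by
    refine le_height_supportIdeal _ S (fun j => Finset.singleton_nonempty _) ?_
    rw [← Finset.sum_add_distrib]
    refine Finset.sum_congr rfl fun j _ => ?_
    have := hd j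
    simp [S]
    omega
  have h3 := Ideal.height_add_one_le_of_lt_of_isPrime h1
  refine lt_of_lt_of_le ?_ (le_trans (add_le_add_left h2 1) h3)
  exact_mod_cast Nat.lt_succ_self _

/-- Modulo `q` every element is a constant, and a nonzero constant cannot lie in the prime ideal
`supportIdeal ∅`. -/
theorem supportIdeal_empty_le {q : Ideal (segreRing d)} (hq : ∀ x, segreCoord x ∈ q)
    (hle : q ≤ supportIdeal (fun j => (∅ : Finset (Fin (d j))))) :
    supportIdeal (fun j => (∅ : Finset (Fin (d j)))) ≤ q := by
  have key : ∀ f : segreRing d, ∃ c : ℂ, f - algebraMap ℂ _ c ∈ q := by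
    rintro ⟨f, hf⟩
    induction hf using Algebra.adjoin_induction with
    | mem f hf =>
      obtain ⟨x, rfl⟩ := hf
      refine ⟨0, ?_⟩
      rw [map_zero, sub_zero]
      exact hq x
    | algebraMap c => exact ⟨c, by convert q.zero_mem; exact sub_eq_zero.2 rfl⟩
    | add f g hf hg h1 h2 =>
      obtain ⟨c, hc⟩ := h1
      obtain ⟨c', hc'⟩ := h2
      refine ⟨c + c', ?_⟩
      have h : ∀ F G : segreRing d, F + G - algebraMap ℂ _ (c + c') =
          F - algebraMap ℂ _ c + (G - algebraMap ℂ _ c') := fun F G => by rw [map_add]; ring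
      have := q.add_mem hc hc'
      rwa [← h] at this
    | mul f g hf hg h1 h2 =>
      obtain ⟨c, hc⟩ := h1
      obtain ⟨c', hc'⟩ := h2
      refine ⟨c * c', ?_⟩
      have h : ∀ F G : segreRing d, F * G - algebraMap ℂ _ (c * c') =
          G * (F - algebraMap ℂ _ c) + algebraMap ℂ _ c * (G - algebraMap ℂ _ c') :=
        fun F G => by rw [map_mul]; ring
      have := q.add_mem (q.mul_mem_left ⟨g, hg⟩ hc) (q.mul_mem_left (algebraMap ℂ _ c) hc')
      rwa [← h] at this
  intro f hf
  obtain ⟨c, hc⟩ := key f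
  have h1 := sub_mem hf (hle hc)
  rw [sub_sub_cancel] at h1
  have h2 : c = 0 := by
    by_contra h
    exact Ideal.IsPrime.ne_top inferInstance
      (Ideal.eq_top_of_isUnit_mem _ h1 ((isUnit_iff_ne_zero.2 h).map (algebraMap ℂ (segreRing d))))
  rwa [h2, map_zero, sub_zero] at hc

/-- A weak form of the Nullstellensatz. -/
theorem exists_algHom_complex {T : Type*} [CommRing T] [Algebra ℂ T] [Algebra.FiniteType ℂ T]
    (q : Ideal T) [q.IsPrime] {t : T} (ht : t ∉ q) :
    ∃ χ : T →ₐ[ℂ] ℂ, (∀ f ∈ q, χ f = 0) ∧ χ t ≠ 0 := by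
  have : IsJacobsonRing T := isJacobsonRing_of_finiteType (A := ℂ)
  -- In a Jacobson ring a prime is the intersection of the maximal ideals above it, so one of these
  -- avoids `t`. Its residue field is finite over ℂ, hence equal to ℂ.
  have hj : q.jacobson = q := IsJacobsonRing.out inferInstance (Ideal.IsPrime.isRadical inferInstance)
  obtain ⟨M, ⟨hqM, hM⟩, htM⟩ : ∃ M ∈ {J : Ideal T | q ≤ J ∧ J.IsMaximal}, t ∉ M := by
    by_contra! h
    exact ht (hj ▸ Ideal.mem_sInf.2 fun {J} hJ => h J hJ)
  let := Ideal.Quotient.field M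
  have : Module.Finite ℂ (T ⧸ M) := finite_of_finite_type_of_isJacobsonRing ℂ (T ⧸ M)
  have hb : Function.Bijective (algebraMap ℂ (T ⧸ M)) :=
    IsAlgClosed.algebraMap_bijective_of_isIntegral
  let e : ℂ ≃ₐ[ℂ] (T ⧸ M) := AlgEquiv.ofBijective (Algebra.ofId ℂ (T ⧸ M)) hb
  refine ⟨(e.symm : (T ⧸ M) →ₐ[ℂ] ℂ).comp (Ideal.Quotient.mkₐ ℂ M), fun f hf => ?_, fun h => ?_⟩
  · have : Ideal.Quotient.mk M f = 0 := Ideal.Quotient.eq_zero_iff_mem.2 (hqM hf)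
    simp [this]
  · refine htM (Ideal.Quotient.eq_zero_iff_mem.1 ?_)
    simpa using h

end Segre

/-! ### Product vectors -/

section Product

variable {m : ℕ} {d : Fin m → ℕ}

/-- The value of the linear functional `⨂ⱼ φⱼ` on the vector `v`. -/
def productPairing (φ : ∀ j, Fin (d j) → ℂ) (v : Idx d → ℂ) : ℂ :=
  ∑ y, (∏ j, φ j (y j)) * v y

/-- Any `∑ⱼ (dⱼ - 1)` vectors are annihilated by a common nonzero product functional. -/
theorem exists_productPairing_eq_zero (hd : ∀ j, 0 < d j) {ι : Type*} [Fintype ι]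
    (v : ι → Idx d → ℂ) (hι : Fintype.card ι ≤ ∑ j, (d j - 1)) :
    ∃ φ : ∀ j, Fin (d j) → ℂ, (∀ j, φ j ≠ 0) ∧ ∀ i, productPairing φ (v i) = 0 := by
  classical
  rcases Nat.eq_zero_or_pos m with rfl | hm
  · have : IsEmpty ι := Fintype.card_eq_zero_iff.1 (by simpa using hι)
    exact ⟨fun j => j.elim0, fun j => j.elim0, fun i => isEmptyElim i⟩
  let f : ι → segreRing d := fun i => ∑ y, v i y • segreCoord y
  let p : Ideal (segreRing d) := supportIdeal fun j => ∅
  have hfp : Ideal.span (Set.range f) ≤ p := by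
    rw [Ideal.span_le]
    rintro _ ⟨i, rfl⟩
    refine Ideal.sum_mem _ fun y _ => ?_
    rw [Algebra.smul_def]
    exact Ideal.mul_mem_left _ _ (segreCoord_mem_supportIdeal.2 ⟨⟨0, hm⟩, by simp⟩)
  -- Krull: a minimal prime over the linear forms `f i` has height at most their number, which is
  -- too small for the irrelevant ideal `p`.
  have hp : p ∉ (Ideal.span (Set.range f)).minimalPrimes := fun h => by
    have h1 := Ideal.height_le_card_of_mem_minimalPrimes_span (Set.finite_range f) h
    have h2 : (Set.range f).ncard ≤ Fintype.card ι := by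
      rw [← Set.image_univ]
      refine (Set.ncard_image_le Set.finite_univ).trans ?_
      rw [Set.ncard_univ, Nat.card_eq_fintype_card]
    have h3 := lt_height_supportIdeal_empty hm hd
    exact absurd (h3.trans_le h1) (not_lt.2 (by exact_mod_cast h2.trans hι))
  obtain ⟨q, hq, hqp⟩ := Ideal.exists_minimalPrimes_le hfp
  have : q.IsPrime := hq.1.1
  obtain ⟨x, hx⟩ : ∃ x, segreCoord x ∉ q := by
    by_contra! h
    exact hp (le_antisymm hqp (supportIdeal_empty_le h hqp) ▸ hq)
  obtain ⟨χ, hχ, hχx⟩ := exists_algHom_complex q hx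
  -- The Segre relations: up to powers of the nonzero coordinate at `x`, the coordinates of the
  -- point `χ` factor over the parties. The factors are its coordinates along the axes through `x`,
  -- which serve as `φ` below.
  have hmul : ∀ y : Idx d, (∏ j, χ (segreCoord (Function.update x j (y j)))) * χ (segreCoord x) =
      χ (segreCoord x) ^ m * χ (segreCoord y) := by
    intro y
    rw [← map_prod, ← map_mul, ← map_pow, ← map_mul]
    congr 1
    apply Subtype.ext
    have h1 : ∀ j, segreMonomial (Function.update x j (y j)) * MvPolynomial.X ⟨j, x j⟩ =
        segreMonomial x * (MvPolynomial.X ⟨j, y j⟩ : MvPolynomial (Σ j, Fin (d j)) ℂ) := by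
      intro j
      unfold segreMonomial
      rw [← Finset.mul_prod_erase _ _ (Finset.mem_univ j),
        ← Finset.mul_prod_erase Finset.univ
          (fun l => (MvPolynomial.X ⟨l, x l⟩ : MvPolynomial (Σ j, Fin (d j)) ℂ))
          (Finset.mem_univ j)]
      have : ∏ l ∈ Finset.univ.erase j, (MvPolynomial.X ⟨l, Function.update x j (y j) l⟩ :
          MvPolynomial (Σ j, Fin (d j)) ℂ) =
          ∏ l ∈ Finset.univ.erase j, MvPolynomial.X ⟨l, x l⟩ :=
        Finset.prod_congr rfl fun l hl => by
          rw [Function.update_of_ne (Finset.ne_of_mem_erase hl)]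
      rw [this, Function.update_self]
      ring
    have h2 := Finset.prod_congr rfl fun j (_ : j ∈ Finset.univ) => h1 j
    rw [Finset.prod_mul_distrib, Finset.prod_mul_distrib, Finset.prod_const, Finset.card_univ,
      Fintype.card_fin] at h2
    push_cast
    exact h2
  refine ⟨fun j i => χ (segreCoord (Function.update x j i)), fun j h => hχx ?_, fun i => ?_⟩
  · simpa using congrFun h (x j)
  · refine (mul_eq_zero.1 ?_).resolve_right hχx
    have h0 : χ (f i) = 0 := hχ _ (hq.1.2 (Ideal.subset_span ⟨i, rfl⟩))
    simp only [f, map_sum, map_smul, smul_eq_mul] at h0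
    rw [productPairing, Finset.sum_mul, ← mul_zero (χ (segreCoord x) ^ m), ← h0, Finset.mul_sum]
    refine Finset.sum_congr rfl fun y _ => ?_
    rw [mul_right_comm, hmul]
    ring

end Product
/-! ### Local operations -/

section TensorOp

open Matrix

variable {m : ℕ} {d e f : Fin m → ℕ}

theorem tensorOp_mul (A : ∀ j, Matrix (Fin (f j)) (Fin (e j)) ℂ)
    (B : ∀ j, Matrix (Fin (e j)) (Fin (d j)) ℂ) :
    tensorOp A * tensorOp B = tensorOp fun j => A j * B j := by
  ext x y
  simp only [tensorOp, mul_apply, of_apply, ← Finset.prod_mul_distrib]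
  rw [Finset.prod_univ_sum, Fintype.piFinset_univ]

theorem tensorOp_one : tensorOp (fun j => (1 : Matrix (Fin (d j)) (Fin (d j)) ℂ)) = 1 := by
  ext x y
  simp only [tensorOp, of_apply, one_apply]
  by_cases h : x = y
  · simp [h]
  · obtain ⟨j, hj⟩ := Function.ne_iff.1 h
    rw [if_neg h]
    exact Finset.prod_eq_zero (Finset.mem_univ j) (if_neg hj)

theorem tensorOp_conjTranspose (B : ∀ j, Matrix (Fin (e j)) (Fin (d j)) ℂ) :
    (tensorOp B)ᴴ = tensorOp fun j => (B j)ᴴ := by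
  ext x y
  simp [tensorOp, conjTranspose_apply]

/-- Linearity of the tensor product in the factor of party `p`, the other factors being independent
of `a`. -/
theorem sum_tensorOp {r : ℕ} (p : Fin m) (M : Fin r → ∀ j, Matrix (Fin (e j)) (Fin (d j)) ℂ)
    (N : ∀ j, Matrix (Fin (e j)) (Fin (d j)) ℂ) (hp : ∑ a, M a p = N p)
    (hN : ∀ a j, j ≠ p → M a j = N j) : ∑ a, tensorOp (M a) = tensorOp N := by
  ext x y
  simp only [tensorOp, Matrix.sum_apply, of_apply]
  rw [← Finset.mul_prod_erase _ _ (Finset.mem_univ p), ← hp, Matrix.sum_apply, Finset.sum_mul]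
  refine Finset.sum_congr rfl fun a _ => ?_
  rw [← Finset.mul_prod_erase _ _ (Finset.mem_univ p)]
  congr 1
  exact Finset.prod_congr rfl fun j hj => by rw [hN a j (Finset.ne_of_mem_erase hj)]

theorem sum_conjTranspose_mul_tensorOp {r : ℕ} {e : Fin r → Fin m → ℕ} (p : Fin m)
    (B : ∀ (a : Fin r) (j : Fin m), Matrix (Fin (e a j)) (Fin (d j)) ℂ)
    (measurement : ∑ a, (B a p)ᴴ * B a p = 1)
    (isometry : ∀ a j, j ≠ p → (B a j)ᴴ * B a j = 1) :
    ∑ a, (tensorOp (B a))ᴴ * tensorOp (B a) = 1 := by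
  simp only [tensorOp_conjTranspose, tensorOp_mul]
  rw [sum_tensorOp p (fun a j => (B a j)ᴴ * B a j) (fun j => 1) measurement isometry, tensorOp_one]

theorem LOCC.sum_eq_one {K : Type} [DecidableEq K] [Fintype K] {E : K → Operator d d}
    (h : LOCC d E) : ∑ k, E k = 1 := by
  induction h with
  | announce d k₀ => simp
  | round d p r e B F hm hi _ ih =>
    rw [Finset.sum_comm]
    simp only [← Matrix.mul_sum, ← Matrix.sum_mul, ih, Matrix.mul_one]
    exact sum_conjTranspose_mul_tensorOp p B hm hi

/-! ### Effects of local protocols are separable -/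

/-- The product functional `⨂ⱼ φⱼ` as a row of coordinates. -/
def productRow (φ : ∀ j, Fin (d j) → ℂ) : Idx d → ℂ := fun y => ∏ j, φ j (y j)

theorem productPairing_eq_dotProduct (φ : ∀ j, Fin (d j) → ℂ) (v : Idx d → ℂ) :
    productPairing φ v = productRow φ ⬝ᵥ v := rfl

/-- The cone generated by the positive rank one operators given by product functionals. -/
def separableCone (d : Fin m → ℕ) : AddSubmonoid (Operator d d) :=
  AddSubmonoid.closure (Set.range fun φ : ∀ j, Fin (d j) → ℂ =>
    vecMulVec (star (productRow φ)) (productRow φ))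

theorem productRow_vecMul_tensorOp (φ : ∀ j, Fin (e j) → ℂ)
    (B : ∀ j, Matrix (Fin (e j)) (Fin (d j)) ℂ) :
    productRow φ ᵥ* tensorOp B = productRow fun j => φ j ᵥ* B j := by
  ext y
  simp only [productRow, vecMul, dotProduct, tensorOp, of_apply, ← Finset.prod_mul_distrib]
  rw [Finset.prod_univ_sum, Fintype.piFinset_univ]

theorem conj_mem_separableCone (B : ∀ j, Matrix (Fin (e j)) (Fin (d j)) ℂ) {M : Operator e e}
    (hM : M ∈ separableCone e) : (tensorOp B)ᴴ * M * tensorOp B ∈ separableCone d := by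
  induction hM using AddSubmonoid.closure_induction with
  | mem M hM =>
    obtain ⟨φ, rfl⟩ := hM
    refine AddSubmonoid.subset_closure ⟨fun j => φ j ᵥ* B j, ?_⟩
    simp only
    rw [← productRow_vecMul_tensorOp, mul_vecMulVec, vecMulVec_mul, star_vecMul]
  | zero => simp
  | add M N _ _ h1 h2 =>
    rw [Matrix.mul_add, Matrix.add_mul]
    exact add_mem h1 h2

theorem one_mem_separableCone : (1 : Operator d d) ∈ separableCone d := by
  have : (1 : Operator d d) = ∑ x : Idx d,
      vecMulVec (star (productRow fun j => Pi.single (x j) 1))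
        (productRow fun j => Pi.single (x j) 1) := by
    have hrow : ∀ x : Idx d, (productRow fun j => Pi.single (x j) 1) = Pi.single x 1 := by
      intro x
      ext y
      have := congrFun (congrFun (tensorOp_one (d := d)) y) x
      simpa [tensorOp, one_apply, productRow, Pi.single_apply] using this
    simp only [hrow]
    ext x y
    simp [Matrix.sum_apply, vecMulVec_apply, one_apply, Pi.single_apply]
  rw [this]
  exact sum_mem fun x _ => AddSubmonoid.subset_closure ⟨_, rfl⟩

theorem LOCC.mem_separableCone {K : Type} [DecidableEq K] {E : K → Operator d d}
    (h : LOCC d E) (k : K) : E k ∈ separableCone d := by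
  induction h with
  | announce d k₀ =>
    by_cases h : k = k₀
    · simpa [h] using one_mem_separableCone
    · simp [h, zero_mem]
  | round d p r e B F hm hi _ ih =>
    exact sum_mem fun a _ => conj_mem_separableCone _ (ih a)

theorem posSemidef_of_mem_separableCone {M : Operator d d} (hM : M ∈ separableCone d) :
    M.PosSemidef := by
  induction hM using AddSubmonoid.closure_induction with
  | mem M hM =>
    obtain ⟨φ, rfl⟩ := hM
    exact posSemidef_vecMulVec_star_self _
  | zero => exact PosSemidef.zero
  | add M N _ _ h1 h2 => exact h1.add h2

theorem LOCC.isPOVM {K : Type} [DecidableEq K] [Fintype K] {E : K → Operator d d}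
    (h : LOCC d E) : IsPOVM E :=
  ⟨fun k => posSemidef_of_mem_separableCone (h.mem_separableCone k), h.sum_eq_one⟩

/-! ### Expectation values -/

theorem expectation_eq_zero_iff (E : Operator d d) (ψ : PureState d) :
    expectation E ψ = 0 ↔ star ψ.rep.ofLp ⬝ᵥ E *ᵥ ψ.rep.ofLp = 0 := by
  have h : (‖ψ.rep‖ : ℂ) ^ 2 ≠ 0 := by simpa using ψ.rep_nonzero
  rw [expectation, div_eq_zero_iff, or_iff_left h, EuclideanSpace.inner_eq_star_dotProduct,
    dotProduct_comm]
  simp [toLpLin_apply]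

theorem star_dotProduct_vecMulVec (φ : ∀ j, Fin (d j) → ℂ) (v : Idx d → ℂ) :
    star v ⬝ᵥ vecMulVec (star (productRow φ)) (productRow φ) *ᵥ v =
      star (productPairing φ v) * productPairing φ v := by
  rw [productPairing_eq_dotProduct, vecMulVec_mulVec, dotProduct_smul, star_dotProduct, star_star]
  simp [mul_comm]

/-- In a sum of positive operators, expectations that vanish do so summand by summand, while a
nonzero expectation at `w` is already nonzero for some summand. -/
theorem exists_productPairing_of_mem_separableCone {M : Operator d d} (hM : M ∈ separableCone d)
    {s : Set (Idx d → ℂ)} {w : Idx d → ℂ} (hs : ∀ v ∈ s, star v ⬝ᵥ M *ᵥ v = 0)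
    (hw : star w ⬝ᵥ M *ᵥ w ≠ 0) :
    ∃ φ : ∀ j, Fin (d j) → ℂ, (∀ v ∈ s, productPairing φ v = 0) ∧ productPairing φ w ≠ 0 := by
  induction hM using AddSubmonoid.closure_induction with
  | mem M hM =>
    obtain ⟨φ, rfl⟩ := hM
    simp only [star_dotProduct_vecMulVec] at hs hw
    exact ⟨φ, fun v hv => by simpa using hs v hv, right_ne_zero_of_mul hw⟩
  | zero => simp at hw
  | add M N hM hN h1 h2 =>
    simp only [add_mulVec, dotProduct_add] at hs hw
    have hM' := (posSemidef_of_mem_separableCone hM).dotProduct_mulVec_nonneg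
    have hN' := (posSemidef_of_mem_separableCone hN).dotProduct_mulVec_nonneg
    have hs' := fun v hv => (add_eq_zero_iff_of_nonneg (hM' v) (hN' v)).1 (hs v hv)
    by_cases h : star w ⬝ᵥ M *ᵥ w = 0
    · exact h2 (fun v hv => (hs' v hv).2) (by simpa [h] using hw)
    · exact h1 (fun v hv => (hs' v hv).1) h

theorem UnambiguouslyLocallyDistinguishable.exists_productPairing {n : ℕ}
    {ψ : Fin n → PureState d} (h : UnambiguouslyLocallyDistinguishable ψ) (k : Fin n) :
    ∃ φ : ∀ j, Fin (d j) → ℂ, (∀ i ≠ k, productPairing φ (ψ i).rep = 0) ∧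
      productPairing φ (ψ k).rep ≠ 0 := by
  obtain ⟨E, -, hE, h⟩ := h
  simp only [expectation_eq_zero_iff] at h
  obtain ⟨φ, h1, h2⟩ := exists_productPairing_of_mem_separableCone (hE.mem_separableCone k.succ)
    (s := {v | ∃ i ≠ k, v = (ψ i).rep.ofLp}) (w := (ψ k).rep.ofLp)
    (by rintro v ⟨i, hi, rfl⟩; exact (h k i).2 hi) (fun h0 => (h k k).1 h0 rfl)
  exact ⟨φ, fun i hi => h1 _ ⟨i, hi, rfl⟩, h2⟩

/-! ### A local protocol that tests product functionals -/

-- The hypothesis on `P j` makes it an orthogonal projection. The parties in `s` measure in turn `P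
-- j` against `1 - P j`; any failure leads to the inconclusive result 0, and `k` is announced only
-- if all succeed.
open Classical in
theorem exists_locc_tensorOp {n : ℕ} (P : ∀ j, Matrix (Fin (d j)) (Fin (d j)) ℂ)
    (hP : ∀ j, (P j)ᴴ * P j = P j) (k : Fin n) (s : Finset (Fin m)) :
    ∃ E : Fin (n + 1) → Operator d d, LOCC d E ∧ (∀ i : Fin n, i ≠ k → E i.succ = 0) ∧
      E k.succ = tensorOp fun j => if j ∈ s then P j else 1 := by
  have hPs : ∀ j, (P j)ᴴ = P j := fun j => by
    rw [← hP j, conjTranspose_mul, conjTranspose_conjTranspose]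
  have hPP : ∀ j, P j * P j = P j := fun j => by
    have := hP j
    rwa [hPs] at this
  induction s using Finset.induction_on with
  | empty =>
    refine ⟨_, LOCC.announce d k.succ, fun i hi => by simp [hi], ?_⟩
    simp [tensorOp_one]
  | insert p s hp ih =>
    obtain ⟨E, hE, h0, hk⟩ := ih
    let B : Fin 2 → ∀ j, Matrix (Fin (d j)) (Fin (d j)) ℂ := fun a j =>
      if j = p then (if a = 0 then P j else 1 - P j) else 1
    let F : Fin 2 → Fin (n + 1) → Operator d d := fun a =>
      if a = 0 then E else fun k => if k = 0 then 1 else 0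
    have hround := LOCC.round d p 2 (fun _ => d) B F
      (by simp [B, Fin.sum_univ_two, hPs, hPP, Matrix.mul_sub, Matrix.sub_mul])
      (fun a j hj => by simp [B, hj])
      (fun a => by
        by_cases ha : a = 0
        · simpa [F, ha] using hE
        · simpa [F, ha] using LOCC.announce d (0 : Fin (n + 1)))
    refine ⟨_, hround, fun i hi => ?_, ?_⟩
    · simp [F, Fin.sum_univ_two, h0 i hi]
    · simp only [F, Fin.sum_univ_two, Fin.isValue, if_true, hk, one_ne_zero, if_false,
        Fin.succ_ne_zero, Matrix.mul_zero, Matrix.zero_mul, add_zero, tensorOp_conjTranspose,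
        tensorOp_mul]
      congr 1
      funext j
      rcases eq_or_ne j p with rfl | hj
      · simp [B, hp, hPs, hPP]
      · simp [B, hj]

open Classical in
/-- A party chooses uniformly at random which of finitely many protocols is followed. -/
theorem LOCC.average {K : Type} [DecidableEq K] {n : ℕ} (hn : 0 < n) (p : Fin m)
    {F : Fin n → K → Operator d d} (hF : ∀ a, LOCC d (F a)) :
    LOCC d fun k => ∑ a, (n : ℂ)⁻¹ • F a k := by
  let c : ℂ := ((Real.sqrt n)⁻¹ : ℝ)
  have hc : star c * c = (n : ℂ)⁻¹ := by
    simp only [c, Complex.star_def, Complex.conj_ofReal, ← Complex.ofReal_mul, ← mul_inv]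
    rw [Real.mul_self_sqrt (Nat.cast_nonneg n)]
    simp
  let B : Fin n → ∀ j, Matrix (Fin (d j)) (Fin (d j)) ℂ := fun a j => if j = p then c • 1 else 1
  have hB : ∀ a, tensorOp (B a) = c • (1 : Operator d d) := fun a => by
    ext x y
    rw [← tensorOp_one]
    simp only [tensorOp, of_apply, Matrix.smul_apply, smul_eq_mul]
    rw [← Finset.mul_prod_erase _ _ (Finset.mem_univ p),
      ← Finset.mul_prod_erase _ (fun j => (1 : Matrix (Fin (d j)) (Fin (d j)) ℂ) (x j) (y j))
        (Finset.mem_univ p), ← mul_assoc]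
    congr 1
    · simp [B]
    · exact Finset.prod_congr rfl fun j hj => by simp [B, Finset.ne_of_mem_erase hj]
  have hround := LOCC.round d p n (fun _ => d) B F
    (by
      have : (n : ℂ) ≠ 0 := by exact_mod_cast hn.ne'
      simp only [B, if_true, conjTranspose_smul, conjTranspose_one,
        Matrix.mul_smul, Matrix.mul_one, smul_smul, mul_comm c, hc, Finset.sum_const, Finset.card_univ,
        Fintype.card_fin]
      rw [← Nat.cast_smul_eq_nsmul ℂ, smul_smul, mul_inv_cancel₀ this, one_smul])
    (fun a j hj => by simp [B, hj]) hF
  convert hround using 4 with k a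
  rw [hB a, conjTranspose_smul, conjTranspose_one, Matrix.smul_mul, Matrix.mul_smul, Matrix.mul_one,
    Matrix.one_mul, smul_smul, mul_comm, hc]

theorem exists_locc_productRow {n : ℕ} (φ : ∀ j, Fin (d j) → ℂ) (hφ : ∀ j, φ j ≠ 0)
    (k : Fin n) : ∃ E : Fin (n + 1) → Operator d d, LOCC d E ∧ (∀ i : Fin n, i ≠ k → E i.succ = 0) ∧
      ∃ c : ℂ, c ≠ 0 ∧ E k.succ = c • vecMulVec (star (productRow φ)) (productRow φ) := by
  -- This factor normalises the rank one operator of `φ j` to a projection.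
  let c : Fin m → ℂ := fun j => (φ j ⬝ᵥ star (φ j))⁻¹
  have hc0 : ∀ j, φ j ⬝ᵥ star (φ j) ≠ 0 := fun j => by
    simpa [dotProduct_star_self_eq_zero] using hφ j
  have hc : ∀ j, star (c j) = c j := fun j => by
    simp only [c, star_inv₀]
    congr 1
    simp [dotProduct, mul_comm]
  have hP : ∀ j, (c j • vecMulVec (star (φ j)) (φ j))ᴴ * (c j • vecMulVec (star (φ j)) (φ j)) =
      c j • vecMulVec (star (φ j)) (φ j) := fun j => by
    rw [conjTranspose_smul, conjTranspose_vecMulVec, star_star, hc, Matrix.smul_mul,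
      Matrix.mul_smul, vecMulVec_mul_vecMulVec, vecMulVec_smul, smul_smul, smul_smul, mul_assoc]
    simp [c, hc0 j]
  obtain ⟨E, hE, h0, hk⟩ := exists_locc_tensorOp _ hP k Finset.univ
  refine ⟨E, hE, h0, ∏ j, c j, Finset.prod_ne_zero_iff.2 fun j _ => inv_ne_zero (hc0 j), ?_⟩
  rw [hk]
  ext x y
  simp [tensorOp, vecMulVec_apply, productRow, Finset.prod_mul_distrib]

theorem unambiguouslyLocallyDistinguishable_of_exists_productPairing {n : ℕ}
    {ψ : Fin n → PureState d} (hn : n ≤ 1 + ∑ j, (d j - 1))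
    (h : ∀ k, ∃ φ : ∀ j, Fin (d j) → ℂ, (∀ j, φ j ≠ 0) ∧
      (∀ i ≠ k, productPairing φ (ψ i).rep = 0) ∧ productPairing φ (ψ k).rep ≠ 0) :
    UnambiguouslyLocallyDistinguishable ψ := by
  choose φ hφ h0 h1 using h
  choose F hF hF0 c hc hFc using fun k => exists_locc_productRow (φ k) (hφ k) k
  have hfinal : ∀ (E : Fin (n + 1) → Operator d d), LOCC d E → ∀ a : ℂ, a ≠ 0 →
      (∀ k, E k.succ = a • F k k.succ) → UnambiguouslyLocallyDistinguishable ψ := by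
    refine fun E hE a ha hEF => ⟨E, hE.isPOVM, hE, fun k j => ?_⟩
    rw [expectation_eq_zero_iff, hEF, hFc, smul_mulVec, dotProduct_smul, smul_mulVec,
      dotProduct_smul, star_dotProduct_vecMulVec, smul_eq_mul, smul_eq_mul, mul_eq_zero,
      or_iff_right ha, mul_eq_zero, or_iff_right (hc k), mul_eq_zero, star_eq_zero, or_self]
    exact ⟨fun h hjk => h1 k (hjk ▸ h), fun h => h0 k j h⟩
  -- Only for two or more states must a party draw `k` at random; then the bound on `n` guarantees
  -- that a party exists.
  rcases n with _ | _ | n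
  · exact hfinal _ (LOCC.announce d 0) 1 one_ne_zero fun k => k.elim0
  · refine hfinal (F 0) (hF 0) 1 one_ne_zero fun k => ?_
    rw [show k = 0 from Subsingleton.elim (α := Fin 1) k 0, one_smul]
  · have hm : 0 < m := by
      rcases Nat.eq_zero_or_pos m with rfl | hm
      · simp at hn
      · exact hm
    refine hfinal _ (LOCC.average (Nat.succ_pos _) ⟨0, hm⟩ hF) ((n + 2 : ℕ) : ℂ)⁻¹
      (inv_ne_zero (Nat.cast_ne_zero.2 (Nat.succ_ne_zero _))) fun k => ?_
    refine Finset.sum_eq_single k (fun a _ hak => ?_) (by simp)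
    rw [hF0 a k hak.symm, smul_zero]

end TensorOp
/-! ### Comparison of the uniform measure with Lebesgue measure -/

section Lebesgue

variable {H : Type*} [NormedAddCommGroup H] [InnerProductSpace ℂ H]

theorem continuous_mk' : Continuous (Projectivization.mk' ℂ (V := H)) :=
  continuous_quotient_mk' (s := projectivizationSetoid ℂ H)

theorem isOpenMap_mk' : IsOpenMap (Projectivization.mk' ℂ (V := H)) := by
  intro s hs
  refine (isQuotientMap_quotient_mk' (s := projectivizationSetoid ℂ H)).isOpen_preimage.1 ?_
  have h : (Projectivization.mk' ℂ) ⁻¹' ((Projectivization.mk' ℂ) '' s) =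
      ⋃ a : ℂˣ, (fun v : {v : H // v ≠ 0} =>
        (⟨a • v.1, (smul_ne_zero_iff_ne a).2 v.2⟩ : {v : H // v ≠ 0})) ⁻¹' s := by
    ext v
    simp only [Set.mem_preimage, Set.mem_image, Set.mem_iUnion]
    constructor
    · rintro ⟨w, hw, hwv⟩
      obtain ⟨a, ha⟩ := (Projectivization.mk_eq_mk_iff ℂ w.1 v.1 w.2 v.2).1 hwv
      exact ⟨a, by simpa only [ha] using hw⟩
    · rintro ⟨a, ha⟩
      exact ⟨_, ha, (Projectivization.mk_eq_mk_iff ℂ _ v.1 _ v.2).2 ⟨a, rfl⟩⟩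
  change IsOpen ((Projectivization.mk' ℂ) ⁻¹' ((Projectivization.mk' ℂ) '' s))
  rw [h]
  exact isOpen_iUnion fun a => hs.preimage (by fun_prop)

open Classical in
/-- The pure state of a vector, where the zero vector is sent to `ψ₀`. -/
def toState (ψ₀ : ℙ ℂ H) (v : H) : ℙ ℂ H :=
  if hv : v = 0 then ψ₀ else Projectivization.mk ℂ v hv

theorem toState_of_ne_zero (ψ₀ : ℙ ℂ H) {v : H} (hv : v ≠ 0) :
    toState ψ₀ v = Projectivization.mk ℂ v hv := dif_neg hv

theorem measurable_toState [MeasurableSpace H] [BorelSpace H] (ψ₀ : ℙ ℂ H) :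
    Measurable (toState ψ₀) := by
  refine measurable_of_continuousOn_compl_singleton 0 ?_
  rw [continuousOn_iff_continuous_domRestrict]
  refine continuous_mk'.congr fun v => ?_
  exact (toState_of_ne_zero ψ₀ v.2).symm

variable [FiniteDimensional ℂ H]

instance secondCountable_projectivization : SecondCountableTopology (ℙ ℂ H) := by
  have : ProperSpace H := FiniteDimensional.proper ℂ H
  exact (isQuotientMap_quotient_mk' (s := projectivizationSetoid ℂ H)).secondCountableTopology
    isOpenMap_mk'

variable [CompleteSpace H]

theorem exists_unitary_smul_eq (ψ φ : ℙ ℂ H) : ∃ U : unitary (H →L[ℂ] H), U • ψ = φ := by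
  induction ψ using Projectivization.ind with
  | h v hv =>
  induction φ using Projectivization.ind with
  | h w hw =>
  -- Both normalised vectors are placed at index 0 of orthonormal bases, so the unitary exchanging
  -- the bases maps one to the other up to scale.
  have hext : ∀ u : H, u ≠ 0 → ∃ b : OrthonormalBasis (Fin (Module.finrank ℂ H)) ℂ H,
      ∃ i, i.1 = 0 ∧ (‖u‖ : ℂ) • b i = u := fun u hu => by
    have : Nontrivial H := ⟨u, 0, hu⟩
    let i : Fin (Module.finrank ℂ H) := ⟨0, Module.finrank_pos⟩
    have hu' : (‖u‖ : ℂ) ≠ 0 := by simpa using hu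
    have ho : Orthonormal ℂ (({i} : Set _).domRestrict
        fun _ : Fin (Module.finrank ℂ H) => (‖u‖ : ℂ)⁻¹ • u) := by
      refine ⟨fun _ => ?_, fun j l hjl => (hjl (Subsingleton.elim j l)).elim⟩
      simp [norm_smul, hu]
    obtain ⟨b, hb⟩ := ho.exists_orthonormalBasis_extension_of_card_eq (by simp)
    exact ⟨b, i, rfl, by rw [hb i rfl, smul_smul, mul_inv_cancel₀ hu', one_smul]⟩
  obtain ⟨b, i, hi, hbv⟩ := hext v hv
  obtain ⟨c, l, hl, hcw⟩ := hext w hw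
  obtain rfl : i = l := Fin.ext (hi.trans hl.symm)
  refine ⟨Unitary.linearIsometryEquiv.symm (b.equiv c (Equiv.refl _)), ?_⟩
  rw [Projectivization.smul_mk, Projectivization.mk_eq_mk_iff']
  refine ⟨(‖v‖ : ℂ) * (‖w‖ : ℂ)⁻¹, ?_⟩
  change _ = b.equiv c (Equiv.refl _) v
  have hw' : (‖w‖ : ℂ) ≠ 0 := by simpa using hw
  calc ((‖v‖ : ℂ) * (‖w‖ : ℂ)⁻¹) • w = ((‖v‖ : ℂ) * (‖w‖ : ℂ)⁻¹) • (‖w‖ : ℂ) • c i := by rw [hcw]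
    _ = (‖v‖ : ℂ) • c i := by rw [smul_smul, mul_assoc, inv_mul_cancel₀ hw', mul_one]
    _ = b.equiv c (Equiv.refl _) ((‖v‖ : ℂ) • b i) := by
      rw [map_smul, OrthonormalBasis.equiv_apply_basis, Equiv.refl_apply]
    _ = b.equiv c (Equiv.refl _) v := by rw [hbv]

/-- A right translate of Haar measure is again left invariant, hence a multiple of it, and the total
masses agree. -/
instance isMulRightInvariant_unitaryHaar : (unitaryHaar H).IsMulRightInvariant := by
  have : (unitaryHaar H).IsHaarMeasure := by unfold unitaryHaar; infer_instance
  refine ⟨fun U => ?_⟩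
  have hm : Measurable fun V : unitary (H →L[ℂ] H) => V * U := measurable_mul_const U
  have : IsProbabilityMeasure ((unitaryHaar H).map (· * U)) :=
    Measure.isProbabilityMeasure_map hm.aemeasurable
  have h := Measure.isMulInvariant_eq_smul_of_compactSpace ((unitaryHaar H).map (· * U))
    (unitaryHaar H)
  have h1 := congrArg (fun μ => μ Set.univ) h
  simp only [measure_univ, Measure.smul_apply] at h1
  rw [h]
  ext s _
  rw [Measure.smul_apply, ENNReal.smul_def, smul_eq_mul]
  rw [ENNReal.smul_def, smul_eq_mul, mul_one] at h1
  rw [← h1, one_mul]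

theorem uniformMeasure_eq (ψ φ : ℙ ℂ H) : uniformMeasure ψ = uniformMeasure φ := by
  obtain ⟨U, rfl⟩ := exists_unitary_smul_eq ψ φ
  unfold uniformMeasure
  conv_lhs => rw [← map_mul_right_eq_self (unitaryHaar H) U]
  rw [Measure.map_map (continuous_unitary_smul ψ).measurable (measurable_mul_const U)]
  congr 1
  funext V
  exact mul_smul V U ψ

/-- Properties of almost all tuples of vectors are properties of almost all tuples of states. -/
theorem ae_pi_uniformMeasure [MeasurableSpace H] [BorelSpace H] (μ : Measure H)
    [μ.IsAddHaarMeasure] {n : ℕ} (ψ₀ : ℙ ℂ H) {S : Set (Fin n → ℙ ℂ H)} (hS : MeasurableSet S)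
    (h : ∀ᵐ v ∂Measure.pi fun _ : Fin n => μ,
      (∀ i, v i ≠ 0) → (fun i => toState ψ₀ (v i)) ∈ S) :
    ∀ᵐ ψ ∂Measure.pi fun _ : Fin n => uniformMeasure ψ₀, ψ ∈ S := by
  have : ProperSpace H := FiniteDimensional.proper ℂ H
  have : Nontrivial H := ⟨ψ₀.rep, 0, ψ₀.rep_nonzero⟩
  let T : Set (Fin n → H) := (fun v i => toState ψ₀ (v i)) ⁻¹' Sᶜ
  let ν := Measure.pi fun _ : Fin n => μ
  have hne : ∀ᵐ v ∂ν, ∀ i, v i ≠ 0 := by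
    refine ae_all_iff.2 fun i =>
      (Measure.quasiMeasurePreserving_eval (fun _ => μ) i).ae (p := fun w => w ≠ 0) ?_
    rw [ae_iff]
    simp
  have h0 : ν T = 0 := by
    rw [measure_eq_zero_iff_ae_notMem]
    filter_upwards [h, hne] with v hv hv'
    exact fun hT => hT (hv hv')
  have hT : MeasurableSet T :=
    hS.compl.preimage (measurable_pi_lambda _ fun i => (measurable_toState ψ₀).comp (measurable_pi_apply i))
  let act : (Fin n → unitary (H →L[ℂ] H)) × (Fin n → H) → Fin n → H := fun p i => p.1 i • p.2 i
  have hact : Measurable act := by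
    refine measurable_pi_lambda _ fun i => ?_
    have hc : Continuous fun p : unitary (H →L[ℂ] H) × H => p.1 • p.2 :=
      (continuous_subtype_val.comp continuous_fst).clm_apply continuous_snd
    have hp : Measurable fun p : (Fin n → unitary (H →L[ℂ] H)) × (Fin n → H) => (p.1 i, p.2 i) :=
      ((measurable_pi_apply i).comp measurable_fst).prodMk
        ((measurable_pi_apply i).comp measurable_snd)
    exact hc.measurable.comp hp
  let η := Measure.pi fun _ : Fin n => unitaryHaar H
  have hW : MeasurableSet (act ⁻¹' T) := hT.preimage hact
  -- For fixed unitaries the action is a linear automorphism, which preserves Lebesgue null sets.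
  -- Fubini in the other order then gives one tuple `v` of nonzero vectors whose random rotation
  -- almost surely avoids `T`.
  have hnull : (η.prod ν) (act ⁻¹' T) = 0 := by
    rw [Measure.prod_apply hW]
    refine (lintegral_congr fun U => ?_).trans lintegral_zero
    let e : (Fin n → H) ≃L[ℝ] (Fin n → H) := ContinuousLinearEquiv.piCongrRight fun i =>
      (Unitary.linearIsometryEquiv (U i)).toContinuousLinearEquiv.restrictScalars ℝ
    change ν (e ⁻¹' T) = 0
    rw [Measure.addHaar_preimage_continuousLinearEquiv, h0, mul_zero]
  rw [Measure.prod_apply_symm hW, lintegral_eq_zero_iff (measurable_measure_prodMk_right hW)] at hnull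
  obtain ⟨v, hv0, hv⟩ := (hnull.and hne).exists
  have hpi : Measure.pi (fun _ : Fin n => uniformMeasure ψ₀) =
      η.map fun U i => U i • toState ψ₀ (v i) := by
    rw [Measure.pi_map_pi (f := fun i (U : unitary (H →L[ℂ] H)) => U • toState ψ₀ (v i))
      (hμ := fun i => inferInstanceAs (SigmaFinite (uniformMeasure (toState ψ₀ (v i)))))
      fun i => (continuous_unitary_smul _).measurable.aemeasurable]
    congr 1
    funext i
    exact uniformMeasure_eq _ _
  change Measure.pi (fun _ : Fin n => uniformMeasure ψ₀) Sᶜ = 0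
  rw [hpi, Measure.map_apply _ hS.compl]
  · refine Eq.trans (congrArg η ?_) hv0
    ext U
    simp only [Set.mem_preimage, Set.mem_compl_iff, T, act]
    congr! 3 with i
    rw [toState_of_ne_zero _ (hv i), toState_of_ne_zero _ ((smul_ne_zero_iff_ne (U i)).2 (hv i)),
      Projectivization.smul_mk]
  · exact measurable_pi_lambda _ fun i =>
      (continuous_unitary_smul _).measurable.comp (measurable_pi_apply i)

end Lebesgue
/-! ### Product functionals on pure states -/

section Overlap

variable {m : ℕ} {d : Fin m → ℕ}

theorem productPairing_smul (φ : ∀ j, Fin (d j) → ℂ) (a : ℂ) (v : Idx d → ℂ) :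
    productPairing φ (a • v) = a * productPairing φ v := by
  simp [productPairing_eq_dotProduct]

theorem productPairing_smul_left (c : Fin m → ℂ) (φ : ∀ j, Fin (d j) → ℂ) (v : Idx d → ℂ) :
    productPairing (fun j => c j • φ j) v = (∏ j, c j) * productPairing φ v := by
  simp only [productPairing, Finset.mul_sum, Pi.smul_apply, smul_eq_mul, Finset.prod_mul_distrib,
    mul_assoc]

/-- The modulus of the value of a product functional on a pure state. -/
def overlap (φ : ∀ j, Fin (d j) → ℂ) (ψ : PureState d) : ℝ :=
  ‖productPairing φ ψ.rep‖ / ‖ψ.rep‖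

theorem overlap_mk (φ : ∀ j, Fin (d j) → ℂ) {v : HilbertSpace d} (hv : v ≠ 0) :
    overlap φ (Projectivization.mk ℂ v hv) = ‖productPairing φ v‖ / ‖v‖ := by
  obtain ⟨a, ha⟩ := Projectivization.exists_smul_eq_mk_rep ℂ v hv
  have ha0 : ‖(a : ℂ)‖ ≠ 0 := norm_ne_zero_iff.2 a.ne_zero
  rw [overlap, ← ha, Units.smul_def, WithLp.ofLp_smul, productPairing_smul, norm_smul, norm_mul,
    mul_div_mul_left _ _ ha0]

theorem overlap_eq_zero_iff {φ : ∀ j, Fin (d j) → ℂ} {ψ : PureState d} :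
    overlap φ ψ = 0 ↔ productPairing φ ψ.rep = 0 := by
  simp [overlap, ψ.rep_nonzero]

theorem productPairing_rep_mk_eq_zero_iff {φ : ∀ j, Fin (d j) → ℂ} {v : HilbertSpace d}
    (hv : v ≠ 0) : productPairing φ (Projectivization.mk ℂ v hv).rep = 0 ↔
      productPairing φ v = 0 := by
  rw [← overlap_eq_zero_iff, overlap_mk]
  simp [hv]

/-- Continuity can be checked on representatives because `mk'` is open: products of open quotient
maps are quotient maps. -/
theorem continuous_overlap :
    Continuous fun p : (∀ j, Fin (d j) → ℂ) × PureState d => overlap p.1 p.2 := by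
  have hq : IsOpenQuotientMap (Projectivization.mk' ℂ (V := HilbertSpace d)) :=
    ⟨Quotient.mk_surjective, continuous_mk', isOpenMap_mk'⟩
  rw [((IsOpenQuotientMap.id (X := ∀ j, Fin (d j) → ℂ)).prodMap hq).isQuotientMap.continuous_iff]
  have : (fun p : (∀ j, Fin (d j) → ℂ) × PureState d => overlap p.1 p.2) ∘
      Prod.map id (Projectivization.mk' ℂ) =
      fun p : (∀ j, Fin (d j) → ℂ) × {v : HilbertSpace d // v ≠ 0} =>
        ‖productPairing p.1 p.2.1‖ / ‖p.2.1‖ := by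
    funext p
    exact overlap_mk p.1 p.2.2
  rw [this]
  refine Continuous.div ?_ (by fun_prop) fun p => norm_ne_zero_iff.2 p.2.2
  unfold productPairing
  fun_prop

/-- Product functionals all of whose factors have (supremum) norm one. -/
def unitFactors (d : Fin m → ℕ) : Set (∀ j, Fin (d j) → ℂ) :=
  Set.univ.pi fun _ => Metric.sphere 0 1

theorem exists_mem_unitFactors {φ : ∀ j, Fin (d j) → ℂ} (hφ : ∀ j, φ j ≠ 0) :
    ∃ φ' ∈ unitFactors d, ∀ ψ : PureState d, overlap φ' ψ = 0 ↔ overlap φ ψ = 0 := by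
  have h0 : ∀ j, ((‖φ j‖⁻¹ : ℝ) : ℂ) ≠ 0 := fun j => by simpa using hφ j
  refine ⟨fun j => ((‖φ j‖⁻¹ : ℝ) : ℂ) • φ j, fun j _ => ?_, fun ψ => ?_⟩
  · have : ‖φ j‖ ≠ 0 := norm_ne_zero_iff.2 (hφ j)
    simp [norm_smul, this]
  · rw [overlap_eq_zero_iff, overlap_eq_zero_iff, productPairing_smul_left, mul_eq_zero,
      or_iff_right (Finset.prod_ne_zero_iff.2 fun j _ => h0 j)]

theorem ne_zero_of_mem_unitFactors {φ : ∀ j, Fin (d j) → ℂ} (hφ : φ ∈ unitFactors d) (j : Fin m) :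
    φ j ≠ 0 := fun h => by
  have := hφ j trivial
  simp [h] at this

/-- Projection along a compact factor is closed. With functionals normalised to `unitFactors`, this
makes the existential conditions on states measurable. -/
theorem isClosed_exists_mem {X Y : Type*} [TopologicalSpace X] [TopologicalSpace Y] {K : Set X}
    (hK : IsCompact K) {C : Set (X × Y)} (hC : IsClosed C) :
    IsClosed {y | ∃ x ∈ K, (x, y) ∈ C} := by
  have : CompactSpace K := isCompact_iff_compactSpace.1 hK
  have h := isClosedMap_snd_of_compactSpace (X := K) (Y := Y) _
    (hC.preimage (f := fun p : K × Y => ((p.1 : X), p.2)) (by fun_prop))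
  convert h
  ext y
  simp

theorem isCompact_unitFactors : IsCompact (unitFactors d) :=
  isCompact_univ_pi fun _ => isCompact_sphere 0 1

/-- Tuples of states of which all but the one with index `k` are annihilated by a common nonzero
product functional. -/
def annihilated (d : Fin m → ℕ) {n : ℕ} (k : Fin n) : Set (Fin n → PureState d) :=
  {ψ | ∃ φ : ∀ j, Fin (d j) → ℂ, (∀ j, φ j ≠ 0) ∧ ∀ i ≠ k, overlap φ (ψ i) = 0}

/-- Tuples of states for which some product functional annihilates exactly the states with index
different from `k`. -/
def singledOut (d : Fin m → ℕ) {n : ℕ} (k : Fin n) : Set (Fin n → PureState d) :=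
  {ψ | ∃ φ : ∀ j, Fin (d j) → ℂ, (∀ j, φ j ≠ 0) ∧ (∀ i ≠ k, overlap φ (ψ i) = 0) ∧
    overlap φ (ψ k) ≠ 0}

theorem continuous_overlap_apply {n : ℕ} (i : Fin n) :
    Continuous fun p : (∀ j, Fin (d j) → ℂ) × (Fin n → PureState d) => overlap p.1 (p.2 i) := by
  have h : Continuous fun p : (∀ j, Fin (d j) → ℂ) × (Fin n → PureState d) => (p.1, p.2 i) :=
    Continuous.prodMk continuous_fst (Continuous.comp (continuous_apply i) continuous_snd)
  have h' := (continuous_overlap (d := d)).comp h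
  exact h'

theorem isClosed_setOf_forall_ne {A B : Type*} [TopologicalSpace A] {n : ℕ} {f : Fin n → A → B}
    [TopologicalSpace B] [T1Space B] (hf : ∀ i, Continuous (f i)) (k : Fin n) (b : B) :
    IsClosed {a | ∀ i ≠ k, f i a = b} := by
  have h : {a | ∀ i ≠ k, f i a = b} = ⋂ i, ⋂ (_ : i ≠ k), f i ⁻¹' {b} := by
    ext a
    simp
  rw [h]
  exact isClosed_iInter fun i => isClosed_iInter fun _ => isClosed_singleton.preimage (hf i)

theorem isClosed_setOf_forall_overlap {n : ℕ} (k : Fin n) :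
    IsClosed {p : (∀ j, Fin (d j) → ℂ) × (Fin n → PureState d) |
      ∀ i ≠ k, overlap p.1 (p.2 i) = 0} :=
  isClosed_setOf_forall_ne continuous_overlap_apply k 0

theorem measurableSet_annihilated {n : ℕ} (k : Fin n) : MeasurableSet (annihilated d k) := by
  refine IsClosed.measurableSet ?_
  convert isClosed_exists_mem isCompact_unitFactors (isClosed_setOf_forall_overlap (d := d) k)
  ext ψ
  constructor
  · rintro ⟨φ, hφ, h⟩
    obtain ⟨φ', hφ', h'⟩ := exists_mem_unitFactors hφ
    exact ⟨φ', hφ', fun i hi => (h' _).2 (h i hi)⟩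
  · rintro ⟨φ, hφ, h⟩
    exact ⟨φ, ne_zero_of_mem_unitFactors hφ, h⟩

theorem measurableSet_singledOut {n : ℕ} (k : Fin n) : MeasurableSet (singledOut d k) := by
  -- Nonvanishing is not a closed condition, so it is exhausted by the closed conditions `1 / (l +
  -- 1) ≤ overlap`.
  have hC : ∀ l : ℕ, IsClosed {p : (∀ j, Fin (d j) → ℂ) × (Fin n → PureState d) |
      (1 : ℝ) / (l + 1) ≤ overlap p.1 (p.2 k)} := fun l =>
    isClosed_le continuous_const (continuous_overlap_apply k)
  have h := MeasurableSet.iUnion fun l : ℕ => (isClosed_exists_mem isCompact_unitFactors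
    ((isClosed_setOf_forall_overlap (d := d) k).inter (hC l))).measurableSet
  convert h
  ext ψ
  simp only [Set.mem_iUnion]
  constructor
  · rintro ⟨φ, hφ, h, hk⟩
    obtain ⟨φ', hφ', h'⟩ := exists_mem_unitFactors hφ
    have hpos : 0 < overlap φ' (ψ k) :=
      lt_of_le_of_ne (by unfold overlap; positivity) (Ne.symm (mt (h' _).1 hk))
    obtain ⟨l, hl⟩ := exists_nat_one_div_lt hpos
    exact ⟨l, φ', hφ', fun i hi => (h' _).2 (h i hi), hl.le⟩
  · rintro ⟨l, φ, hφ, h, hl⟩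
    exact ⟨φ, ne_zero_of_mem_unitFactors hφ, h,
      (lt_of_lt_of_le (by positivity : (0 : ℝ) < 1 / (l + 1)) hl).ne'⟩

end Overlap

/-! ### Genericity -/

section Generic

variable {m : ℕ} {d : Fin m → ℕ}

/-- A C¹ map does not raise Hausdorff dimension. -/
theorem addHaar_range_eq_zero {E F : Type*} [NormedAddCommGroup E] [NormedSpace ℝ E]
    [FiniteDimensional ℝ E] [NormedAddCommGroup F] [NormedSpace ℝ F] [FiniteDimensional ℝ F]
    [MeasurableSpace F] [BorelSpace F] (ν : Measure F) [ν.IsAddHaarMeasure] {f : E → F}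
    (hf : ContDiff ℝ 1 f) (h : Module.finrank ℝ E < Module.finrank ℝ F) :
    ν (Set.range f) = 0 := by
  refine measure_zero_of_dimH_lt (d := Module.finrank ℝ F) ?_
    (hf.dimH_range_le.trans_lt (by exact_mod_cast h))
  rw [NNReal.coe_natCast]
  exact Measure.absolutelyContinuous_isAddHaarMeasure _ _

theorem addHaar_productPairing_eq_zero (μ : Measure (HilbertSpace d)) [μ.IsAddHaarMeasure]
    {φ : ∀ j, Fin (d j) → ℂ} (hφ : ∀ j, φ j ≠ 0) :
    μ {v | productPairing φ v = 0} = 0 := by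
  let s : Submodule ℝ (HilbertSpace d) :=
    { carrier := {v | productPairing φ v = 0}
      add_mem' := fun {v w} hv hw => by
        simp only [Set.mem_ofPred_eq, productPairing_eq_dotProduct] at *
        rw [WithLp.ofLp_add, dotProduct_add, hv, hw, add_zero]
      zero_mem' := by simp [productPairing]
      smul_mem' := fun a v hv => by
        simp only [Set.mem_ofPred_eq, productPairing_eq_dotProduct] at *
        rw [WithLp.ofLp_smul, dotProduct_smul, hv, smul_zero] }
  refine Measure.addHaar_submodule μ s fun hs => ?_
  choose y hy using fun j => Function.ne_iff.1 (hφ j)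
  have : EuclideanSpace.single y 1 ∈ s := hs ▸ Submodule.mem_top
  have h0 : productPairing φ (EuclideanSpace.single y (1 : ℂ)) = 0 := this
  simp only [productPairing, PiLp.ofLp_single, Pi.single_apply, mul_ite, mul_one, mul_zero,
    Finset.sum_ite_eq', Finset.mem_univ, if_true] at h0
  exact Finset.prod_ne_zero_iff.2 (fun j _ => hy j) h0

theorem ae_mem_singledOut (hd : ∀ j, 0 < d j) {n : ℕ} (hn : n ≤ 1 + ∑ j, (d j - 1)) (k : Fin n)
    (ψ₀ : PureState d) :
    ∀ᵐ ψ ∂Measure.pi fun _ : Fin n => uniformMeasure ψ₀, ψ ∈ singledOut d k := by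
  let μ : Measure (HilbertSpace d) := Measure.addHaar
  refine ae_pi_uniformMeasure μ ψ₀ (measurableSet_singledOut k) (Filter.Eventually.mono ?_
    fun v (hv : (fun i => toState ψ₀ (v i)) ∈ singledOut d k) _ => hv)
  obtain _ | n := n
  · exact k.elim0
  let e := MeasurableEquiv.piFinSuccAbove (fun _ : Fin (n + 1) => HilbertSpace d) k
  let W : Set (Fin (n + 1) → HilbertSpace d) :=
    (fun v i => toState ψ₀ (v i)) ⁻¹' (singledOut d k)ᶜ
  have hW : MeasurableSet W := (measurableSet_singledOut k).compl.preimage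
    (measurable_pi_lambda _ fun i => (measurable_toState ψ₀).comp (measurable_pi_apply i))
  change Measure.pi (fun _ => μ) W = 0
  have he := (measurePreserving_piFinSuccAbove (fun _ : Fin (n + 1) => μ) k).measure_preimage_equiv
    (e.symm ⁻¹' W)
  have hWe : e ⁻¹' (e.symm ⁻¹' W) = W := by
    ext v
    simp
  change Measure.pi (fun _ => μ) (e ⁻¹' (e.symm ⁻¹' W)) = _ at he
  rw [hWe] at he
  rw [he, Measure.prod_apply_symm (hW.preimage e.symm.measurable)]
  refine (lintegral_congr fun w => ?_).trans lintegral_zero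
  -- The functional depends only on the other states `w`, so for fixed `w` the bad choices of the
  -- `k`-th vector lie in its kernel, a null set.
  obtain ⟨φ, hφ, h⟩ := exists_productPairing_eq_zero hd
    (fun i : Fin n => (toState ψ₀ (w i)).rep.ofLp) (by simpa using by omega)
  refine measure_mono_null (fun a ha => ?_) (addHaar_productPairing_eq_zero μ hφ)
  by_contra hne
  have ha : (fun i => toState ψ₀ (k.insertNth (α := fun _ => HilbertSpace d) a w i)) ∉
      singledOut d k := ha
  refine ha ⟨φ, hφ, fun i hi => ?_, ?_⟩
  · obtain ⟨l, rfl⟩ := Fin.exists_succAbove_eq hi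
    rw [overlap_eq_zero_iff]
    simpa using h l
  · have ha0 : a ≠ 0 := by
      rintro rfl
      exact hne (by simp [productPairing])
    rw [Ne, overlap_eq_zero_iff]
    simpa [toState_of_ne_zero _ ha0,
      productPairing_rep_mk_eq_zero_iff ha0] using hne

/-- The factors of a product functional in the affine chart in which the coordinates `x` are one. -/
def chartFactors (x : Idx d) (t : (Σ j, {y : Fin (d j) // y ≠ x j}) → ℂ) (j : Fin m)
    (y : Fin (d j)) : ℂ :=
  if h : y = x j then 1 else t ⟨j, y, h⟩

/-- Tuples of vectors of which all but the one with index `k` are annihilated by a product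
functional in the chart `x`, parametrised by the product functional, the remaining coordinates of
the annihilated vectors, and the vector with index `k`. -/
def annihilatedChart {n : ℕ} (k : Fin n) (x : Idx d)
    (p : ((Σ j, {y : Fin (d j) // y ≠ x j}) → ℂ) ×
      ({i : Fin n // i ≠ k} × {y : Idx d // y ≠ x} → ℂ) × HilbertSpace d) :
    Fin n → HilbertSpace d := fun i =>
  if hi : i = k then p.2.2 else WithLp.toLp 2 fun y =>
    -- In the chart the functional has coefficient 1 at `x`, so the equation can be solved for this
    -- coordinate.
    if hy : y = x then
      -∑ z : {y : Idx d // y ≠ x}, (∏ j, chartFactors x p.1 j (z.1 j)) * p.2.1 (⟨i, hi⟩, z)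
    else p.2.1 (⟨i, hi⟩, ⟨y, hy⟩)

theorem contDiff_annihilatedChart {n : ℕ} (k : Fin n) (x : Idx d) :
    ContDiff ℝ 1 (annihilatedChart k x) := by
  rw [contDiff_pi]
  intro i
  by_cases hi : i = k
  · simp only [annihilatedChart, hi, dif_pos]
    fun_prop
  · simp only [annihilatedChart, hi, dif_neg, not_false_eq_true]
    let e := (PiLp.continuousLinearEquiv 2 ℂ fun _ : Idx d => ℂ).symm
    refine (e.toContinuousLinearMap.restrictScalars ℝ).contDiff.comp (contDiff_pi.2 fun y => ?_)
    by_cases hy : y = x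
    · simp only [hy, dif_pos]
      refine (ContDiff.sum fun z _ => ContDiff.mul (contDiff_prod fun j _ => ?_) (by fun_prop)).neg
      unfold chartFactors
      split_ifs <;> fun_prop
    · simp only [hy, dif_neg, not_false_eq_true]
      fun_prop

theorem exists_mem_range_annihilatedChart {n : ℕ} {k : Fin n} {v : Fin n → HilbertSpace d}
    {φ : ∀ j, Fin (d j) → ℂ} (hφ : ∀ j, φ j ≠ 0) (h : ∀ i ≠ k, productPairing φ (v i) = 0) :
    ∃ x, v ∈ Set.range (annihilatedChart k x) := by
  choose x hx using fun j => Function.ne_iff.1 (hφ j)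
  refine ⟨x, ⟨(fun s => (φ s.1 (x s.1))⁻¹ * φ s.1 s.2, fun p => v p.1 p.2.1, v k), ?_⟩⟩
  funext i
  by_cases hi : i = k
  · subst hi
    simp [annihilatedChart]
  · ext y
    simp only [annihilatedChart, hi, dif_neg, not_false_eq_true]
    by_cases hy : y = x
    · subst hy
      have hchart : ∀ j z, chartFactors y (fun s => (φ s.1 (y s.1))⁻¹ * φ s.1 s.2) j z =
          ((φ j (y j))⁻¹ • φ j) z := fun j z => by
        by_cases hz : z = y j
        · simpa [chartFactors, hz] using (inv_mul_cancel₀ (hx j)).symm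
        · simp [chartFactors, hz]
      have h1 := productPairing_smul_left (fun j => (φ j (y j))⁻¹) φ (v i)
      rw [h i hi, mul_zero, productPairing, ← Finset.add_sum_erase _ _ (Finset.mem_univ y)] at h1
      have h2 : ∏ j, ((φ j (y j))⁻¹ • φ j) (y j) = 1 := Finset.prod_eq_one fun j _ => by
        simpa using inv_mul_cancel₀ (hx j)
      rw [h2, one_mul] at h1
      simp only [dif_pos, hchart]
      rw [neg_eq_iff_add_eq_zero, add_comm, ← h1]
      congr 1
      rw [← Finset.sum_subtype (Finset.univ.erase y) (by simp)
        (fun z => (∏ j, ((φ j (y j))⁻¹ • φ j) (z j)) * v i z)]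
    · simp [hy]

theorem ae_notMem_annihilated (hd : ∀ j, 0 < d j) {n : ℕ} (hn : 1 + ∑ j, (d j - 1) < n)
    (k : Fin n) (ψ₀ : PureState d) :
    ∀ᵐ ψ ∂Measure.pi fun _ : Fin n => uniformMeasure ψ₀, ψ ∉ annihilated d k := by
  let μ : Measure (HilbertSpace d) := Measure.addHaar
  refine ae_pi_uniformMeasure μ ψ₀ (measurableSet_annihilated k).compl ?_
  have hnull : ∀ x : Idx d, Measure.pi (fun _ : Fin n => μ) (Set.range (annihilatedChart k x)) = 0 := by
    intro x
    refine addHaar_range_eq_zero _ (contDiff_annihilatedChart k x) ?_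
    rw [finrank_real_of_complex, finrank_real_of_complex]
    have hD : 0 < ∏ j, d j := Finset.prod_pos fun j _ => hd j
    simp only [Module.finrank_prod, Module.finrank_fintype_fun_eq_card, Fintype.card_sigma,
      Fintype.card_prod, Fintype.card_subtype_compl, Fintype.card_unique, Fintype.card_fin,
      finrank_euclideanSpace, Fintype.card_pi, Module.finrank_pi_fintype, Finset.sum_const,
      Finset.card_univ, smul_eq_mul]
    -- The chart has N + (n - 1)(D - 1) + D complex parameters against the nD of the target, a
    -- deficit of n - 1 - N > 0.
    generalize ∏ j, d j = D at hD
    generalize ∑ j, (d j - 1) = N at hn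
    obtain ⟨b, rfl⟩ := Nat.exists_eq_add_of_lt hD
    obtain ⟨a, rfl⟩ := Nat.exists_eq_add_of_lt hn
    have h1 : 1 + N + a + 1 - 1 = 1 + N + a := by omega
    have h2 : 0 + b + 1 - 1 = b := by omega
    rw [h1, h2]
    nlinarith
  filter_upwards [ae_all_iff.2 fun x => measure_eq_zero_iff_ae_notMem.1 (hnull x)] with v hv hv0
  rintro ⟨φ, hφ, h⟩
  obtain ⟨x, hx⟩ := exists_mem_range_annihilatedChart (v := v) (k := k) hφ fun i hi => by
    have := h i hi
    dsimp only at this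
    rwa [overlap_eq_zero_iff, toState_of_ne_zero _ (hv0 i),
      productPairing_rep_mk_eq_zero_iff (hv0 i)] at this
  exact hv x hx

end Generic

end LocalDiscrimination

end

/-! ### The threshold for almost all tuples -/

theorem mainTheorem4 (m : ℕ) (d : Fin m → ℕ) (hd : ∀ j, 0 < d j) (n : ℕ)
    (ψ₀ : LocalDiscrimination.PureState d) :
    ∀ᵐ ψ : Fin n → LocalDiscrimination.PureState d
        ∂(MeasureTheory.Measure.pi fun _ : Fin n => LocalDiscrimination.uniformMeasure ψ₀),
      (LocalDiscrimination.UnambiguouslyLocallyDistinguishable ψ ↔ n ≤ 1 + ∑ j, (d j - 1)) := by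
  rcases le_or_gt n (1 + ∑ j, (d j - 1)) with hn | hn
  · filter_upwards [ae_all_iff.2 fun k => LocalDiscrimination.ae_mem_singledOut hd hn k ψ₀] with ψ hψ
    refine iff_of_true ?_ hn
    refine LocalDiscrimination.unambiguouslyLocallyDistinguishable_of_exists_productPairing hn
      fun k => ?_
    obtain ⟨φ, hφ, h, hk⟩ := hψ k
    exact ⟨φ, hφ, fun i hi => LocalDiscrimination.overlap_eq_zero_iff.1 (h i hi),
      mt LocalDiscrimination.overlap_eq_zero_iff.2 hk⟩
  -- Above the threshold, failure for a single index already excludes discrimination.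
  · have k : Fin n := ⟨0, by omega⟩
    filter_upwards [LocalDiscrimination.ae_notMem_annihilated hd hn k ψ₀] with ψ hψ
    refine iff_of_false (fun h => hψ ?_) hn.not_ge
    obtain ⟨φ, h, hk⟩ := h.exists_productPairing k
    -- A functional with a zero factor vanishes identically, so it could not detect the state `ψ k`.
    refine ⟨φ, fun j hj => hk ?_, fun i hi => LocalDiscrimination.overlap_eq_zero_iff.2 (h i hi)⟩
    refine Finset.sum_eq_zero fun y _ => ?_
    rw [Finset.prod_eq_zero (Finset.mem_univ j) (by rw [hj]; rfl), zero_mul]
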